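/- Model. A network is an $n$-vertex undirected graph $G=(V,E)$ whose vertices have distinct identity numbers from $\{1,\dots,n\}$. Computation is deterministic and proceeds in synchronous rounds. In each round every vertex may send a message (of any size) through each of its ports to the neighbor at that port, receives the messages that its neighbors sent to it in this round, and performs an arbitrary local computation. Initially a vertex knows only its own identity number and the parameters of the procedure; the numbering of the ports is arbitrary. A vertex that has produced its output halts and sends nothing more. The running time is the number of rounds until all vertices have halted. Definitions. The arboricity of $G$ is the minimal number of edge-disjoint forests that cover $E$. A partial orientation $\sigma$ of $G$ directs each edge of some subset of $E$ towards one of its endpoints. It is acyclic if it has no directed cycle. Its out-degree is the maximum over $v\in V$ of the number of edges directed out of $v$; its length is the maximum number of edges of a directed path; its deficit is the maximum over $v\in V$ of the number of undirected edges incident to $v$. An $m$-defective $p$-coloring is a coloring with colors $1,\dots,p$ in which every vertex has at most $m$ neighbors of its own color. An $H$-partition with $\ell$ sets and degree at most $d$ is a partition $V=H_1\cup\dots\cup H_\ell$ (empty sets allowed) such that every $v\in H_i$ has at most $d$ neighbors in $\bigcup_{j\ge i}H_j$. Procedure Partial-Orientation, for a constant $\epsilon>0$, with integer parameters $a\ge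 0$ (a bound on the arboricity) and $t>0$: (1) compute an $H$-partition $H_1,\dots,H_\ell$ of $G$ of degree at most $\lfloor(2+\epsilon)a\rfloor$; (2) compute, for all $i$ in parallel, an $\lfloor a/t\rfloor$-defective coloring of the induced subgraph $G(H_i)$ with $p=O(t^2)$ colors; (3) orient each edge between different $H$-sets towards the set with the greater index, orient each edge inside an $H$-set whose endpoints have different colors towards the endpoint with the greater color, and leave the other edges unoriented. Theorem. For every real $\epsilon>0$ there are a constant $C=C(\epsilon)>0$ and a distributed implementation of Procedure Partial-Orientation in this model such that the following holds for all integers $a\ge0$ and $t>0$ and for every $n$-vertex network $G$ of arboricity at most $a$. Every vertex halts and outputs the index of its $H$-set, its color, and the status (outgoing, incoming or unoriented) of each of its incident edges, all as described in (1)--(3), with $p\le Ct^2$ and, if $n\ge2$, with $\ell\le C\log_2 n$. The statuses announced form a partial orientation of $G$ that is acyclic and has out-degree at most $\lfloor(2+\epsilon)a\rfloor$, length at most $C\,t^2\log_2 n$, and deficit at most $\lfloor a/t\rfloor$. If $n\ge2$, the running time is at most $C\log_2 n$. -/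

import Mathlib

universe u

namespace DistOrient

/-! ### Arboricity -/

/-- The edge set of `G` is the disjoint union of the edge sets of `k` forests. -/
def HasForestDecomposition {V : Type u} (G : SimpleGraph V) (k : ℕ) : Prop :=
  ∃ F : Fin k → SimpleGraph V,
    (∀ i, (F i).IsAcyclic) ∧
    (∀ i j, i ≠ j → Disjoint (F i).edgeSet (F j).edgeSet) ∧
    (⋃ i, (F i).edgeSet) = G.edgeSet

/-- The minimal number of edge-disjoint forests that cover the edge set of `G`. -/
noncomputable def arboricity {V : Type u} (G : SimpleGraph V) : ℕ :=
  sInf {k : ℕ | HasForestDecomposition G k}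

/-! ### Partial orientations -/

/-- An orientation of some of the edges of `G`: `dir v u` says that the edge `vu` is oriented
from `v` towards `u`. -/
structure PartialOrientation {V : Type u} (G : SimpleGraph V) where
  dir : V → V → Prop
  adj_of_dir : ∀ v u, dir v u → G.Adj v u
  asymm : ∀ v u, dir v u → ¬ dir u v

/-- How a vertex sees one of its incident edges. -/
inductive EdgeLabel where
  | outgoing
  | incoming
  | unoriented

namespace PartialOrientation

variable {V : Type u} {G : SimpleGraph V} (σ : PartialOrientation G)

/-- There is no directed cycle. -/
def IsAcyclic : Prop := ∀ v, ¬ Relation.TransGen σ.dir v v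

/-- The number of edges that are oriented out of `v`. -/
noncomputable def outDegreeAt (v : V) : ℕ := {u | σ.dir v u}.ncard

/-- The number of edges incident to `v` that are not oriented. -/
noncomputable def deficitAt (v : V) : ℕ :=
  {u | G.Adj v u ∧ ¬ σ.dir v u ∧ ¬ σ.dir u v}.ncard

/-- The length of a longest directed path that emanates from `v`. -/
noncomputable def lengthAt (v : V) : ℕ :=
  sSup {l : ℕ | ∃ p : Fin (l + 1) → V,
    Function.Injective p ∧ p 0 = v ∧ ∀ i : Fin l, σ.dir (p i.castSucc) (p i.succ)}

noncomputable def outDegree [Fintype V] : ℕ := Finset.univ.sup σ.outDegreeAt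

noncomputable def deficit [Fintype V] : ℕ := Finset.univ.sup σ.deficitAt

noncomputable def length [Fintype V] : ℕ := Finset.univ.sup σ.lengthAt

open Classical in
/-- The status of the edge `vu` from the point of view of `v`. -/
noncomputable def label (v u : V) : EdgeLabel :=
  if σ.dir v u then .outgoing else if σ.dir u v then .incoming else .unoriented

end PartialOrientation

/-! ### H-partitions and defective colorings -/

/-- The sets `H_i = {v | h v = i}`, `1 ≤ i ≤ l`, partition the vertex set, and each vertex of
`H_i` has at most `d` neighbors in the union of the `H_j` with `i ≤ j`. -/
def IsHPartition {V : Type u} (G : SimpleGraph V) (h : V → ℕ) (l d : ℕ) : Prop :=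
  (∀ v, 1 ≤ h v ∧ h v ≤ l) ∧ ∀ v, {u | G.Adj v u ∧ h v ≤ h u}.ncard ≤ d

/-- `φ` is an `m`-defective `p`-coloring of `G`, with the colors `1, …, p`. -/
def IsDefectiveColoring {V : Type u} (G : SimpleGraph V) (m p : ℕ) (φ : V → ℕ) : Prop :=
  (∀ v, 1 ≤ φ v ∧ φ v ≤ p) ∧ ∀ v, {u | G.Adj v u ∧ φ u = φ v}.ncard ≤ m

/-- An edge between different `H`-sets is oriented towards the set with the greater index, an edge
inside an `H`-set is oriented towards the endpoint with the greater color, and it remains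
unoriented if its endpoints have the same color. -/
def orientationOf {V : Type u} (G : SimpleGraph V) (h φ : V → ℕ) : PartialOrientation G where
  dir v u := G.Adj v u ∧ (h v < h u ∨ (h v = h u ∧ φ v < φ u))
  adj_of_dir _ _ hd := hd.1
  asymm _ _ hd hd' := by omega

/-! ### The synchronous message passing model -/

/-- A network: a graph whose `n` vertices have distinct identity numbers from `{1, …, n}`. Each
vertex addresses its neighbors through ports: port `i` of `v` leads to the `i`-th entry of
`ports v`, and the order of the ports is arbitrary. -/
structure Network (V : Type u) [Fintype V] where
  graph : SimpleGraph V
  id : V → ℕ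
  id_injective : Function.Injective id
  one_le_id : ∀ v, 1 ≤ id v
  id_le : ∀ v, id v ≤ Fintype.card V
  ports : V → List V
  ports_nodup : ∀ v, (ports v).Nodup
  mem_ports : ∀ v u, u ∈ ports v ↔ graph.Adj v u

/-- A deterministic distributed algorithm: the program that every vertex runs. Initially a vertex
knows only its identity number. In each round it may send a message through each of its ports, and
then it updates its state according to the messages received, listed by port (`none` stands for no
message). A vertex halts as soon as its state carries an output. -/
structure Algorithm (Out : Type) where
  State : Type
  Msg : Type
  init : ℕ → State
  send : State → ℕ → Option Msg
  receive : State → List (Option Msg) → State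
  output : State → Option Out

namespace Algorithm

variable {Out : Type} (A : Algorithm Out) {V : Type u} [Fintype V] (N : Network V)

/-- What a vertex in state `s` sends through port `i`; a vertex that has halted is silent. -/
def emit (s : A.State) (i : ℕ) : Option A.Msg :=
  match A.output s with
  | none => A.send s i
  | some _ => none

open Classical in
/-- One synchronous round; a vertex that has halted keeps its state. The vertex `v` receives from
its neighbor `u` what `u` sends through the port of `u` that leads to `v`. -/
noncomputable def round (s : V → A.State) (v : V) : A.State :=
  match A.output (s v) with
  | none => A.receive (s v)
      ((N.ports v).map fun u => A.emit (s u) ((N.ports u).idxOf v))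
  | some _ => s v

/-- The states of the vertices after a number of rounds. -/
noncomputable def stateAfter : ℕ → V → A.State
  | 0 => fun v => A.init (N.id v)
  | r + 1 => A.round N (stateAfter r)

/-- All vertices have halted after at most `T` rounds, and their outputs are given by `out`. -/
def ComputesWithin (T : ℕ) (out : V → Out) : Prop :=
  ∀ v, A.output (A.stateAfter N T v) = some (out v)

end Algorithm

/-- What a vertex computes in the partial orientation procedure: the index of its `H`-set, its
color within that set, and, for each of its ports, the status of the edge at that port. -/
structure VertexOutput where
  hIndex : ℕ
  color : ℕ
  edge : ℕ → EdgeLabel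

open Classical in
/-- Each vertex announces for each of its incident edges the status that `σ` gives to it. -/
def Announces {V : Type u} [Fintype V] (N : Network V) (out : V → VertexOutput)
    (σ : PartialOrientation N.graph) : Prop :=
  ∀ v u, N.graph.Adj v u → (out v).edge ((N.ports v).idxOf u) = σ.label v u

/-- The outputs are those of the partial orientation procedure: an `H`-partition with at most `l`
sets and degree at most `d`, an `m`-defective `p`-coloring of the subgraph induced by each of the
`H`-sets, and the orientation of the edges that these determine. -/
structure IsPartialOrientationOutput {V : Type u} [Fintype V] (N : Network V)
    (out : V → VertexOutput) (l d m p : ℕ) : Prop where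
  hPartition : IsHPartition N.graph (fun v => (out v).hIndex) l d
  coloring : ∀ i, IsDefectiveColoring (N.graph.induce {v | (out v).hIndex = i}) m p
    (fun v => (out v.1).color)
  orientation : Announces N out
    (orientationOf N.graph (fun v => (out v).hIndex) (fun v => (out v).color))

end DistOrient

namespace DistOrient

/-! ### Sparsity of graphs of small arboricity -/

/-! Peeling. A forest on a vertex set `S` has at most `|S|` edges, so arboricity at most `a` leaves
the subgraph induced by `S` with at most `a|S|` edges. With `d = ⌊(2+ε)a⌋`, the vertices having more
than `d` remaining neighbors make up at most a `2/(2+ε)` fraction of those that remain. Removing all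
others in every round empties the graph in `O(log n)` rounds, and the removal round is the
`H`-index.

Coloring. A vertex does not know `n`, so it starts from the bit length of its own identity number,
taken as its level, and descends to level 0. From level `i+1` to level `i`, colors name polynomials
of degree at most two over the field with `2^(s+i)` elements, and a vertex moves to a pair (point,
value). Two polynomials agree at most twice, so averaging over the points gives one where at most
`2d/2^(s+i)` differently colored neighbors in the `H`-set collide. These defects form a geometric
series with sum at most `4d/2^s`, and `2^s` of order `t` makes this at most `a/t` with `O(t^2)`
colors (`IsLevelColoring.countP_le`). One level per round is fast enough, as `O(log n)` rounds are
allowed.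

Distributed execution. A vertex descends only when the colors it needs are settled, so an
asynchronous start does no harm (`procState_col`), and the highest level still falls in every round
once peeling is over (`procState_level_le`). Arcs increase the pair (`H`-index, color)
lexicographically, which gives acyclicity and the length bound. -/

open Classical in
lemma card_edgeFinset_le_of_isAcyclic {V : Type u} [Fintype V] {F : SimpleGraph V}
    (hF : F.IsAcyclic) : F.edgeFinset.card ≤ Fintype.card V := by
  rcases isEmpty_or_nonempty V with hV | hV
  · have : F.edgeFinset = ∅ := by
      ext e
      exact e.ind fun x _ => hV.elim x
    simp [this]
  · obtain ⟨T, hFT, -, hT⟩ :=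
      (SimpleGraph.connected_top (V := V)).exists_isTree_le_of_le_of_isAcyclic le_top hF
    have h1 := hT.card_edgeFinset
    have h2 : F.edgeFinset.card ≤ T.edgeFinset.card :=
      Finset.card_le_card (SimpleGraph.edgeFinset_mono hFT)
    omega

open Classical in
lemma card_adj_pairs_le_of_isAcyclic {V : Type u} [Fintype V] {F : SimpleGraph V}
    (hF : F.IsAcyclic) (S : Finset V) :
    ((S ×ˢ S).filter fun p => F.Adj p.1 p.2).card ≤ 2 * S.card := by
  have h1 := card_edgeFinset_le_of_isAcyclic (hF.induce (S : Set V))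
  have h2 := (F.induce (S : Set V)).two_mul_card_edgeFinset
  have h3 : Fintype.card (S : Set V) = S.card := by simp
  rw [h3] at h1
  refine le_trans ?_ (h2.symm.le.trans (Nat.mul_le_mul_left 2 h1))
  refine Finset.card_le_card_of_surjOn (fun q : (↑S : Set V).Elem × (↑S : Set V).Elem => (q.1.1, q.2.1)) ?_
  rintro ⟨x, y⟩ hxy
  simp only [Finset.coe_filter, Finset.mem_product, Set.mem_ofPred_eq] at hxy
  exact ⟨(⟨x, hxy.1.1⟩, ⟨y, hxy.1.2⟩), by simpa using hxy.2, rfl⟩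

/-- One forest per edge suffices. This makes the infimum defining `arboricity` attained, rather than
the default value 0 of an empty set. -/
lemma exists_hasForestDecomposition {V : Type u} [Fintype V] (G : SimpleGraph V) :
    ∃ k, HasForestDecomposition G k := by
  classical
  let e := G.edgeFinset.equivFin
  refine ⟨_, fun i => SimpleGraph.fromEdgeSet {(e.symm i : Sym2 V)}, ?_, ?_, ?_⟩
  · intro i
    have h := (SimpleGraph.isAcyclic_bot (V := V))
    rcases hd : (e.symm i : Sym2 V) with ⟨x, y⟩
    have hxy : G.Adj x y := by
      have := (e.symm i).2
      rw [SimpleGraph.mem_edgeFinset, hd] at this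
      exact this
    have := h.sup_edge_of_not_reachable (u := x) (v := y) (by simpa using hxy.ne)
    change (SimpleGraph.fromEdgeSet {(e.symm i : Sym2 V)}).IsAcyclic
    rw [hd]
    simpa [SimpleGraph.edge] using this
  · intro i j hij
    rw [Set.disjoint_left]
    intro z hz hz'
    simp only [SimpleGraph.edgeSet_fromEdgeSet, Set.mem_sdiff, Set.mem_singleton_iff] at hz hz'
    exact hij (e.symm.injective (Subtype.ext (hz.1.symm.trans hz'.1)))
  · ext z
    simp only [SimpleGraph.edgeSet_fromEdgeSet, Set.mem_iUnion, Set.mem_sdiff,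
      Set.mem_singleton_iff]
    constructor
    · rintro ⟨i, rfl, -⟩
      exact SimpleGraph.mem_edgeFinset.1 (e.symm i).2
    · intro hz
      exact ⟨e ⟨z, SimpleGraph.mem_edgeFinset.2 hz⟩, by simp, G.not_isDiag_of_mem_edgeSet hz⟩

open Classical in
/-- A subgraph induced by `S` has at most `arboricity G * |S|` edges. -/
lemma card_adj_pairs_le {V : Type u} [Fintype V] {G : SimpleGraph V} {a : ℕ}
    (hG : arboricity G ≤ a) (S : Finset V) :
    ((S ×ˢ S).filter fun p => G.Adj p.1 p.2).card ≤ 2 * a * S.card := by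
  obtain ⟨F, hF, -, hFG⟩ : HasForestDecomposition G (arboricity G) :=
    Nat.sInf_mem (exists_hasForestDecomposition G)
  have hsub : ((S ×ˢ S).filter fun p => G.Adj p.1 p.2) ⊆
      Finset.univ.biUnion fun i => (S ×ˢ S).filter fun p => (F i).Adj p.1 p.2 := by
    intro p hp
    rw [Finset.mem_filter] at hp
    have : s(p.1, p.2) ∈ ⋃ i, (F i).edgeSet := by rw [hFG]; exact hp.2
    obtain ⟨i, hi⟩ := Set.mem_iUnion.1 this
    exact Finset.mem_biUnion.2 ⟨i, Finset.mem_univ _, Finset.mem_filter.2 ⟨hp.1, hi⟩⟩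
  calc _ ≤ _ := Finset.card_le_card hsub
    _ ≤ ∑ i, ((S ×ˢ S).filter fun p => (F i).Adj p.1 p.2).card := Finset.card_biUnion_le
    _ ≤ ∑ _i : Fin (arboricity G), 2 * S.card :=
      Finset.sum_le_sum fun i _ => card_adj_pairs_le_of_isAcyclic (hF i) S
    _ = arboricity G * (2 * S.card) := by simp
    _ ≤ a * (2 * S.card) := Nat.mul_le_mul_right _ hG
    _ = _ := by ring

/-! ### Peeling off vertices of small degree -/

open Classical in
/-- The vertices that remain after `i` rounds, in each of which the vertices with at most `d`
remaining neighbors are removed. -/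
noncomputable def remaining {V : Type u} [Fintype V] (G : SimpleGraph V) (d : ℕ) : ℕ → Finset V
  | 0 => Finset.univ
  | i + 1 => (remaining G d i).filter fun v =>
      d < ((remaining G d i).filter fun u => G.Adj v u).card

lemma remaining_antitone {V : Type u} [Fintype V] (G : SimpleGraph V) (d : ℕ) :
    Antitone (remaining G d) :=
  antitone_nat_of_succ_le fun _ => Finset.filter_subset _ _

/-- Double counting of adjacent ordered pairs: each survivor is the first entry of at least `d + 1`
of them. -/
lemma card_remaining_succ_mul_le {V : Type u} [Fintype V] {G : SimpleGraph V} {a : ℕ}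
    (hG : arboricity G ≤ a) (d i : ℕ) :
    (remaining G d (i + 1)).card * (d + 1) ≤ 2 * a * (remaining G d i).card := by
  classical
  refine le_trans ?_ (card_adj_pairs_le hG (remaining G d i))
  rw [Finset.card_filter, Finset.sum_product]
  simp only [← Finset.card_filter]
  calc _ = ∑ _v ∈ remaining G d (i + 1), (d + 1) := by simp
    _ ≤ ∑ v ∈ remaining G d (i + 1), ((remaining G d i).filter fun u => G.Adj v u).card := by
      refine Finset.sum_le_sum fun v hv => ?_
      rw [remaining, Finset.mem_filter] at hv
      convert Nat.succ_le_of_lt hv.2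
    _ ≤ _ := Finset.sum_le_sum_of_subset (Finset.filter_subset _ _)

lemma card_remaining_le {V : Type u} [Fintype V] {G : SimpleGraph V} {a : ℕ}
    (hG : arboricity G ≤ a) {ε : ℝ} (hε : 0 < ε) (i : ℕ) :
    ((remaining G ⌊(2 + ε) * (a : ℝ)⌋₊ i).card : ℝ) ≤
      (2 / (2 + ε)) ^ i * Fintype.card V := by
  induction i with
  | zero => simp [remaining]
  | succ i ih =>
    set d := ⌊(2 + ε) * (a : ℝ)⌋₊
    have h1 : ((remaining G d (i + 1)).card : ℝ) * (d + 1) ≤ 2 * a * (remaining G d i).card := by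
      exact_mod_cast card_remaining_succ_mul_le hG d i
    have h2 : (2 + ε) * (a : ℝ) < d + 1 := Nat.lt_floor_add_one _
    have h3 : ((remaining G d (i + 1)).card : ℝ) ≤ 2 / (2 + ε) * (remaining G d i).card := by
      -- For `a > 0` the factor `a` cancels from `(2+ε)a < d + 1`; for `a = 0` no vertex survives
      -- the round.
      rcases Nat.eq_zero_or_pos a with rfl | ha
      · have : ((remaining G d (i + 1)).card : ℝ) ≤ 0 := by
          norm_num at h1 h2
          nlinarith [Nat.cast_nonneg (α := ℝ) (remaining G d (i + 1)).card]
        exact this.trans (by positivity)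
      · have ha' : (0 : ℝ) < a := by exact_mod_cast ha
        have h4 : ((remaining G d (i + 1)).card : ℝ) * ((2 + ε) * a) ≤
            2 * a * (remaining G d i).card :=
          le_trans (by gcongr) h1
        rw [div_mul_eq_mul_div, le_div_iff₀ (by positivity)]
        refine le_of_mul_le_mul_right ?_ ha'
        linarith
    calc _ ≤ _ := h3
      _ ≤ 2 / (2 + ε) * ((2 / (2 + ε)) ^ i * Fintype.card V) := by gcongr
      _ = _ := by ring

/-- After logarithmically many rounds no vertex remains. -/
lemma exists_remaining_eq_empty {ε : ℝ} (hε : 0 < ε) :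
    ∃ C : ℝ, 0 < C ∧ ∀ (V : Type u) [Fintype V] (G : SimpleGraph V) (a : ℕ),
      arboricity G ≤ a → ∃ l : ℕ, remaining G ⌊(2 + ε) * (a : ℝ)⌋₊ l = ∅ ∧
        (2 ≤ Fintype.card V → (l : ℝ) ≤ C * Real.logb 2 (Fintype.card V)) := by
  have hb : 1 < (2 + ε) / 2 := by rw [lt_div_iff₀ (by norm_num)]; linarith
  have hlog : 0 < Real.log ((2 + ε) / 2) := Real.log_pos hb
  have hlog2 : 0 < Real.log 2 := Real.log_pos (by norm_num)
  refine ⟨Real.log 2 / Real.log ((2 + ε) / 2) + 1, by positivity, fun V _ G a hG => ?_⟩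
  set n := Fintype.card V with hn
  -- `K` is the logarithm of `n` to the base `(2+ε)/2`. The summand 1 in the constant pays for
  -- rounding up, as `log₂ n ≥ 1` when `n ≥ 2`.
  set K : ℝ := Real.log n / Real.log ((2 + ε) / 2)
  refine ⟨⌊K⌋₊ + 1, ?_, fun h2 => ?_⟩
  · rcases Nat.eq_zero_or_pos n with h0 | hpos
    · have : IsEmpty V := Fintype.card_eq_zero_iff.1 h0
      exact Finset.eq_empty_of_isEmpty _
    rw [← Finset.card_eq_zero, ← Nat.lt_one_iff]
    have h1 := card_remaining_le hG hε (⌊K⌋₊ + 1)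
    have hn0 : (0 : ℝ) < n := by exact_mod_cast hpos
    have h3 : (n : ℝ) < ((2 + ε) / 2) ^ (⌊K⌋₊ + 1) := by
      rw [← Real.log_lt_log_iff hn0 (by positivity), Real.log_pow, ← div_lt_iff₀ hlog]
      push_cast
      exact Nat.lt_floor_add_one K
    have h4 : (2 / (2 + ε)) ^ (⌊K⌋₊ + 1) * (n : ℝ) < 1 := by
      rw [← inv_div, inv_pow, inv_mul_lt_iff₀ (by positivity), mul_one]
      exact h3
    exact_mod_cast h1.trans_lt h4
  · have hn2 : (2 : ℝ) ≤ n := by exact_mod_cast h2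
    have hK : 0 ≤ K := div_nonneg (Real.log_nonneg (by linarith)) hlog.le
    have hl : 1 ≤ Real.logb 2 n := by
      rw [Real.le_logb_iff_rpow_le (by norm_num) (by linarith)]
      simpa using hn2
    have hK' : Real.log 2 / Real.log ((2 + ε) / 2) * Real.logb 2 n = K := by
      rw [Real.logb]
      field_simp
      simp only [K]
      field_simp
    push_cast
    rw [add_mul, hK', one_mul]
    exact add_le_add (Nat.floor_le hK) hl

/-! ### A family of functions any two of which agree in at most two points -/

/-- The functions are the polynomials of degree at most two over the field of order `2^s`, of which
there are `(2^s)^3`; the difference of two of them has at most two roots. -/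
lemma exists_family_agreeing_at_most_twice (s : ℕ) (hs : s ≠ 0) :
    ∃ f : ℕ → ℕ → ℕ, (∀ c x, f c x < 2 ^ s) ∧
      ∀ c c', c < (2 ^ s) ^ 3 → c' < (2 ^ s) ^ 3 → c ≠ c' →
        ((Finset.range (2 ^ s)).filter fun x => f c x = f c' x).card ≤ 2 := by
  classical
  let F := GaloisField 2 s
  have : Fintype F := Fintype.ofFinite F
  have hcard : Fintype.card F = 2 ^ s := by
    rw [← Nat.card_eq_fintype_card]
    exact GaloisField.card 2 s hs
  let e : F ≃ Fin (2 ^ s) := Fintype.equivFinOfCardEq hcard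
  have hcard3 : Fintype.card (F × F × F) = (2 ^ s) ^ 3 := by
    rw [Fintype.card_prod, Fintype.card_prod, hcard]; ring
  let g : F × F × F ≃ Fin ((2 ^ s) ^ 3) := Fintype.equivFinOfCardEq hcard3
  -- Coding reduces modulo the number of objects, so it is injective only below that bound.
  let co : ℕ → F × F × F := fun c => g.symm (Fin.ofNat _ c)
  let pt : ℕ → F := fun x => e.symm (Fin.ofNat _ x)
  let ev : F × F × F → F → F := fun p x => p.1 * x ^ 2 + p.2.1 * x + p.2.2
  have hpt : ∀ x < 2 ^ s, ∀ y < 2 ^ s, pt x = pt y → x = y := by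
    intro x hx y hy h
    have := congrArg Fin.val (e.symm.injective h)
    simpa [Nat.mod_eq_of_lt hx, Nat.mod_eq_of_lt hy] using this
  refine ⟨fun c x => e (ev (co c) (pt x)), fun c x => (e _).2, fun c c' hc hc' hne => ?_⟩
  have hco : co c ≠ co c' := by
    intro h
    have := congrArg Fin.val (g.symm.injective h)
    exact hne (by simpa [Nat.mod_eq_of_lt hc, Nat.mod_eq_of_lt hc'] using this)
  let P : Polynomial F := Polynomial.C ((co c).1 - (co c').1) * Polynomial.X ^ 2 +
    Polynomial.C ((co c).2.1 - (co c').2.1) * Polynomial.X +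
    Polynomial.C ((co c).2.2 - (co c').2.2)
  have hP : P ≠ 0 := by
    intro h
    have h0 := congrArg (fun Q => Polynomial.coeff Q 0) h
    have h1 := congrArg (fun Q => Polynomial.coeff Q 1) h
    have h2 := congrArg (fun Q => Polynomial.coeff Q 2) h
    simp [P, -map_sub, Polynomial.coeff_X, Polynomial.coeff_C, Polynomial.coeff_X_pow] at h0 h1 h2
    exact hco (Prod.ext (sub_eq_zero.1 h2) (Prod.ext (sub_eq_zero.1 h1) (sub_eq_zero.1 h0)))
  have hroots : P.roots.toFinset.card ≤ 2 :=
    (Multiset.toFinset_card_le _).trans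
      ((Polynomial.card_roots' P).trans Polynomial.natDegree_quadratic_le)
  refine le_trans (Finset.card_le_card_of_injOn pt ?_ ?_) hroots
  · intro x hx
    simp only [Finset.coe_filter, Set.mem_ofPred_eq] at hx
    have h := e.injective (Fin.ext hx.2)
    simp only [ev] at h
    simp only [Finset.mem_coe, Multiset.mem_toFinset]
    rw [Polynomial.mem_roots hP, Polynomial.IsRoot]
    simp only [P, Polynomial.eval_add, Polynomial.eval_mul, Polynomial.eval_C,
      Polynomial.eval_pow, Polynomial.eval_X]
    linear_combination h
  · intro x hx y hy h
    simp only [Finset.coe_filter, Set.mem_ofPred_eq, Finset.mem_range] at hx hy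
    exact hpt x hx.1 y hy.1 h

/-- The value at `x` of the function with code `c`, over the field with `2 ^ s` elements. -/
noncomputable def codeVal (s : ℕ) : ℕ → ℕ → ℕ :=
  if hs : s ≠ 0 then (exists_family_agreeing_at_most_twice s hs).choose else fun _ _ => 0

lemma codeVal_lt (s c x : ℕ) : codeVal s c x < 2 ^ s := by
  unfold codeVal
  split_ifs with hs
  · exact (exists_family_agreeing_at_most_twice s hs).choose_spec.1 c x
  · positivity

lemma card_codeVal_eq_le {s c c' : ℕ} (hs : s ≠ 0) (hc : c < (2 ^ s) ^ 3)
    (hc' : c' < (2 ^ s) ^ 3) (hne : c ≠ c') :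
    ((Finset.range (2 ^ s)).filter fun x => codeVal s c x = codeVal s c' x).card ≤ 2 := by
  unfold codeVal
  rw [dif_pos hs]
  exact (exists_family_agreeing_at_most_twice s hs).choose_spec.2 c c' hc hc' hne

/-! ### One step of color reduction -/

/-- The number of colors in `L` that differ from `c` and whose function agrees with that of `c`
at `x`. -/
noncomputable def conflicts (s c : ℕ) (L : List ℕ) (x : ℕ) : ℕ :=
  L.countP fun c' => decide (c' ≠ c ∧ codeVal s c' x = codeVal s c x)

lemma sum_conflicts_le {s c : ℕ} {L : List ℕ} (hs : s ≠ 0) (hc : c < (2 ^ s) ^ 3)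
    (hL : ∀ c' ∈ L, c' < (2 ^ s) ^ 3) :
    ∑ x ∈ Finset.range (2 ^ s), conflicts s c L x ≤ 2 * L.length := by
  induction L with
  | nil => simp [conflicts]
  | cons b L ih =>
    have hb := hL b (by simp)
    have h1 := ih fun c' h => hL c' (by simp [h])
    have h2 : ∑ x ∈ Finset.range (2 ^ s),
        (if b ≠ c ∧ codeVal s b x = codeVal s c x then 1 else 0) ≤ 2 := by
      by_cases hbc : b = c
      · simp [hbc]
      · simpa [hbc] using card_codeVal_eq_le hs hb hc hbc
    simp only [conflicts, List.countP_cons, Finset.sum_add_distrib, List.length_cons,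
      decide_eq_true_eq] at h1 h2 ⊢
    omega

/-- Pigeonhole: at most `2d` conflicts are spread over `2^s` points. -/
lemma exists_conflicts_le {s c d : ℕ} {L : List ℕ} (hs : s ≠ 0) (hc : c < (2 ^ s) ^ 3)
    (hL : ∀ c' ∈ L, c' < (2 ^ s) ^ 3) (hd : L.length ≤ d) :
    ∃ x < 2 ^ s, conflicts s c L x ≤ 2 * d / 2 ^ s := by
  by_contra! h
  have h1 := sum_conflicts_le hs hc hL
  have h2 : ∑ x ∈ Finset.range (2 ^ s), (2 * d / 2 ^ s + 1) ≤
      ∑ x ∈ Finset.range (2 ^ s), conflicts s c L x :=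
    Finset.sum_le_sum fun x hx => h x (Finset.mem_range.1 hx)
  simp only [Finset.sum_const, Finset.card_range, smul_eq_mul] at h2
  have h3 := Nat.lt_mul_div_succ (2 * d) (pow_pos (by norm_num : 0 < 2) s)
  omega

open Classical in
/-- The point at which a vertex of color `c` evaluates its function, given the colors `L` of its
neighbors. -/
noncomputable def pickPoint (s d c : ℕ) (L : List ℕ) : ℕ :=
  if h : ∃ x < 2 ^ s, conflicts s c L x ≤ 2 * d / 2 ^ s then h.choose else 0

lemma pickPoint_lt (s d c : ℕ) (L : List ℕ) : pickPoint s d c L < 2 ^ s := by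
  unfold pickPoint
  split_ifs with h
  · exact h.choose_spec.1
  · positivity

lemma conflicts_pickPoint_le {s c d : ℕ} {L : List ℕ} (hs : s ≠ 0) (hc : c < (2 ^ s) ^ 3)
    (hL : ∀ c' ∈ L, c' < (2 ^ s) ^ 3) (hd : L.length ≤ d) :
    conflicts s c L (pickPoint s d c L) ≤ 2 * d / 2 ^ s := by
  have h := exists_conflicts_le hs hc hL hd
  unfold pickPoint
  rw [dif_pos h]
  exact h.choose_spec.2

/-- The new color of a vertex of color `c` whose neighbors have the colors `L`. The colors below
`b` are not used. -/
noncomputable def recolor (b s d c : ℕ) (L : List ℕ) : ℕ :=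
  b + (pickPoint s d c L * 2 ^ s + codeVal s c (pickPoint s d c L))

lemma le_recolor (b s d c : ℕ) (L : List ℕ) : b ≤ recolor b s d c L := Nat.le_add_right _ _

lemma recolor_lt (b s d c : ℕ) (L : List ℕ) : recolor b s d c L < b + (2 ^ s) ^ 2 := by
  have h1 := pickPoint_lt s d c L
  have h2 := codeVal_lt s c (pickPoint s d c L)
  unfold recolor
  nlinarith

/-- After subtraction of `b`, the point and the value are the quotient and the remainder modulo
`2^s`. -/
lemma recolor_eq_iff {b s d c c' : ℕ} {L L' : List ℕ} :
    recolor b s d c L = recolor b s d c' L' ↔ pickPoint s d c L = pickPoint s d c' L' ∧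
      codeVal s c (pickPoint s d c L) = codeVal s c' (pickPoint s d c' L') := by
  have h2 := codeVal_lt s c (pickPoint s d c L)
  have h2' := codeVal_lt s c' (pickPoint s d c' L')
  constructor
  · intro h
    have h3 := Nat.add_left_cancel h
    have hd := congrArg (· / 2 ^ s) h3
    have hm := congrArg (· % 2 ^ s) h3
    have hp : 0 < 2 ^ s := by positivity
    simp only [Nat.mul_add_mod', Nat.mod_eq_of_lt h2, Nat.mod_eq_of_lt h2'] at hm
    simp only [mul_comm _ (2 ^ s), Nat.mul_add_div hp, Nat.div_eq_of_lt h2,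
      Nat.div_eq_of_lt h2', add_zero] at hd
    exact ⟨hd, hm⟩
  · rintro ⟨h1, h3⟩
    unfold recolor
    rw [h1] at h3 ⊢
    rw [h3]

/-! ### Halting simulation of a synchronous system -/

/-- A synchronous system without halting: in each round every vertex learns the states of its
neighbors. Final states do not change any more. -/
structure SyncSystem (Out : Type) where
  State : Type
  init : ℕ → State
  step : State → List State → State
  final : State → Prop
  step_of_final : ∀ x L, final x → step x L = x
  out : State → List State → Out

namespace SyncSystem

variable {Out : Type} (S : SyncSystem Out) {V : Type u} [Fintype V] (N : Network V)

/-- The states of the vertices after a number of rounds. -/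
def trajectory : ℕ → V → S.State
  | 0 => fun v => S.init (N.id v)
  | r + 1 => fun v => S.step (trajectory r v) ((N.ports v).map (trajectory r))

lemma trajectory_succ_of_final {r : ℕ} {v : V} (h : S.final (S.trajectory N r v)) :
    S.trajectory N (r + 1) v = S.trajectory N r v :=
  S.step_of_final _ _ h

open Classical in
/-- Every vertex broadcasts its state, and it keeps the previous states of its neighbors and of
itself. It halts when all of these are final. The state of a neighbor that is silent has not
changed. -/
noncomputable def toAlgorithm : Algorithm Out where
  State := S.State × Option (S.State × List S.State)
  Msg := S.State
  init i := (S.init i, none)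
  send s _ := some s.1
  receive s ms :=
    -- The innermost default `s.1` is never used: in the first round nobody has halted, and later a
    -- remembered list exists.
    let L := ms.mapIdx fun i m => m.getD (((s.2.map Prod.snd).getD []).getD i s.1)
    (S.step s.1 L, some (s.1, L))
  output s := s.2.bind fun q =>
    if S.final q.1 ∧ ∀ y ∈ q.2, S.final y then some (S.out q.1 q.2) else none

/-- Halting loses nothing: a silent neighbor was already final in the remembered round, so its
remembered state is still current, and a halted vertex has stored states that can no longer change.
-/
lemma stateAfter_toAlgorithm (r : ℕ) (v : V) :
    S.toAlgorithm.stateAfter N (r + 1) v = (S.trajectory N (r + 1) v,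
      some (S.trajectory N r v, (N.ports v).map (S.trajectory N r))) := by
  classical
  induction r generalizing v with
  | zero =>
    have hL : (((N.ports v).map fun u => S.toAlgorithm.emit (S.toAlgorithm.stateAfter N 0 u)
        ((N.ports u).idxOf v)).mapIdx fun i m => m.getD (([] : List S.State).getD i
          (S.init (N.id v)))) = (N.ports v).map (S.trajectory N 0) := by
      refine List.ext_getElem
        (List.length_mapIdx.trans ((List.length_map _).trans (List.length_map _).symm)) fun i h1 h2 => ?_
      refine Eq.trans ?_ (List.getElem_map (S.trajectory N 0)).symm
      simp only [List.getElem_mapIdx, List.getElem_map]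
      rfl
    exact congrArg (fun L => (S.step (S.init (N.id v)) L, some (S.init (N.id v), L))) hL
  | succ r ih =>
    rw [Algorithm.stateAfter, Algorithm.round]
    by_cases hv : S.final (S.trajectory N r v) ∧
        ∀ y ∈ (N.ports v).map (S.trajectory N r), S.final y
    · have ho : S.toAlgorithm.output (S.toAlgorithm.stateAfter N (r + 1) v) =
          some (S.out (S.trajectory N r v) ((N.ports v).map (S.trajectory N r))) := by
        rw [ih v]
        exact if_pos hv
      have hmap : (N.ports v).map (S.trajectory N (r + 1)) =
          (N.ports v).map (S.trajectory N r) :=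
        List.map_congr_left fun u hu =>
          S.trajectory_succ_of_final N (hv.2 _ (List.mem_map_of_mem hu))
      have h1 := S.trajectory_succ_of_final N hv.1
      have h2 := S.trajectory_succ_of_final N (r := r + 1) (v := v) (by rw [h1]; exact hv.1)
      simp only [ho]
      rw [ih v, hmap, h2, h1]
    · have ho : S.toAlgorithm.output (S.toAlgorithm.stateAfter N (r + 1) v) = none := by
        rw [ih v]
        exact if_neg hv
      simp only [ho]
      have hL : (((N.ports v).map fun u => S.toAlgorithm.emit
          (S.toAlgorithm.stateAfter N (r + 1) u) ((N.ports u).idxOf v)).mapIdx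
            fun i m => m.getD (((N.ports v).map (S.trajectory N r)).getD i
              (S.trajectory N (r + 1) v))) = (N.ports v).map (S.trajectory N (r + 1)) := by
        refine List.ext_getElem
          (List.length_mapIdx.trans ((List.length_map _).trans (List.length_map _).symm)) fun i h1 h2 => ?_
        refine Eq.trans ?_ (List.getElem_map (S.trajectory N (r + 1))).symm
        simp only [List.getElem_mapIdx, List.getElem_map]
        simp only [List.length_mapIdx, List.length_map] at h1
        rw [List.getD_eq_getElem _ _ (by simpa using h1), List.getElem_map]
        set u := (N.ports v)[i]
        by_cases hu : S.final (S.trajectory N r u) ∧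
            ∀ y ∈ (N.ports u).map (S.trajectory N r), S.final y
        · have hou : S.toAlgorithm.output (S.toAlgorithm.stateAfter N (r + 1) u) =
              some (S.out (S.trajectory N r u) ((N.ports u).map (S.trajectory N r))) := by
            rw [ih u]
            exact if_pos hu
          rw [Algorithm.emit]
          simp only [hou]
          exact (S.trajectory_succ_of_final N hu.1).symm
        · have hou : S.toAlgorithm.output (S.toAlgorithm.stateAfter N (r + 1) u) = none := by
            rw [ih u]
            exact if_neg hu
          rw [Algorithm.emit]
          simp only [hou]
          rw [ih u]
          rfl
      rw [ih v]
      exact congrArg (fun L => (S.step (S.trajectory N (r + 1) v) L,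
        some (S.trajectory N (r + 1) v, L))) hL

/-- The extra round lets each vertex see that its neighbors are final. -/
lemma computesWithin_toAlgorithm {T : ℕ} (hT : ∀ v, S.final (S.trajectory N T v)) :
    S.toAlgorithm.ComputesWithin N (T + 1) fun v =>
      S.out (S.trajectory N T v) ((N.ports v).map (S.trajectory N T)) := by
  classical
  intro v
  rw [stateAfter_toAlgorithm]
  exact if_pos ⟨hT v, by simpa using fun u _ => hT u⟩

end SyncSystem

/-! ### The partial orientation procedure -/

/-- The state of a vertex: whether it has joined an `H`-set, the number of rounds before it joined,
and its colors at the levels from `level` on. -/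
structure ProcState where
  joined : Prop
  clock : ℕ
  level : ℕ
  col : ℕ → ℕ

open Classical in
/-- A vertex joins when at most `d` of its neighbors have not joined. Then it lowers its level
whenever its neighbors have joined and those of its own `H`-set are not at a higher level. -/
noncomputable def procStep (d s : ℕ) (x : ProcState) (L : List ProcState) : ProcState :=
  if x.joined then
    -- A neighbor at the same or a lower level already has its final color at level `x.level`,
    -- because `col` keeps the colors of the higher levels.
    if x.level ≠ 0 ∧ ∀ y ∈ L, y.joined ∧ (y.clock = x.clock → y.level ≤ x.level) then
      { x with
        level := x.level - 1
        col := Function.update x.col (x.level - 1)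
          (recolor (2 ^ (x.level - 1)) (s + (x.level - 1)) d (x.col x.level)
            ((L.filter fun y => y.clock = x.clock).map fun y => y.col x.level)) }
    else x
  else
    { x with
      clock := x.clock + 1
      joined := (L.countP fun y => decide (¬ y.joined)) ≤ d }

open Classical in
/-- The status of the edge from a vertex to its neighbor. -/
noncomputable def procLabel (x y : ProcState) : EdgeLabel :=
  if x.clock < y.clock ∨ (x.clock = y.clock ∧ x.col 0 < y.col 0) then .outgoing
  else if y.clock < x.clock ∨ (y.clock = x.clock ∧ y.col 0 < x.col 0) then .incoming
  else .unoriented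

noncomputable def procSystem (d s : ℕ) : SyncSystem VertexOutput where
  State := ProcState
  -- The identity number serves as the color at every level from its bit length upwards.
  init i := ⟨False, 0, Nat.size i, fun _ => i⟩
  step := procStep d s
  final x := x.joined ∧ x.level = 0
  step_of_final x L h := by simp [procStep, h.1, h.2]
  out x L := ⟨x.clock, x.col 0, fun i => (L[i]?).elim .unoriented (procLabel x)⟩

/-! ### The index of the `H`-set -/

section

variable {V : Type u} [Fintype V] (N : Network V)

lemma ncard_adj_eq_countP (v : V) (P : V → Prop) [DecidablePred P] :
    {u | N.graph.Adj v u ∧ P u}.ncard = (N.ports v).countP fun u => decide (P u) := by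
  classical
  have h : {u | N.graph.Adj v u ∧ P u} =
      (((N.ports v).filter fun u => decide (P u)).toFinset : Set V) := by
    ext u
    simp [N.mem_ports]
  rw [h, Set.ncard_coe_finset, List.toFinset_card_of_nodup ((N.ports_nodup v).filter _),
    List.countP_eq_length_filter]

/-- The round in which `v` is removed. -/
noncomputable def removalTime (G : SimpleGraph V) (d : ℕ) (v : V) : ℕ :=
  sInf {i | v ∉ remaining G d i}

variable {G : SimpleGraph V} {d l : ℕ}

lemma mem_remaining_iff (hl : remaining G d l = ∅) (v : V) (i : ℕ) :
    v ∈ remaining G d i ↔ i < removalTime G d v := by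
  have hne : {i | v ∉ remaining G d i}.Nonempty := ⟨l, by simp [hl]⟩
  constructor
  · intro h
    by_contra! hle
    exact Nat.sInf_mem hne (remaining_antitone G d hle h)
  · intro h
    by_contra hv
    exact absurd (Nat.sInf_le (s := {i | v ∉ remaining G d i}) hv) (not_le.2 h)

lemma one_le_removalTime (hl : remaining G d l = ∅) (v : V) : 1 ≤ removalTime G d v :=
  (mem_remaining_iff hl v 0).1 (by simp [remaining])

lemma removalTime_le (hl : remaining G d l = ∅) (v : V) : removalTime G d v ≤ l := by
  by_contra! h
  simpa [hl] using (mem_remaining_iff hl v l).2 h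

lemma succ_lt_removalTime_iff (hl : remaining G d l = ∅) {v : V} {i : ℕ}
    (hi : i < removalTime G d v) :
    i + 1 < removalTime G d v ↔ d < {u | G.Adj v u ∧ i < removalTime G d u}.ncard := by
  classical
  have h : {u | G.Adj v u ∧ i < removalTime G d u} =
      ((remaining G d i).filter fun u => G.Adj v u : Finset V) := by
    ext u
    simp [mem_remaining_iff hl, and_comm]
  rw [h, Set.ncard_coe_finset, ← mem_remaining_iff hl, remaining, Finset.mem_filter,
    and_iff_right ((mem_remaining_iff hl v i).2 hi)]

lemma isHPartition_removalTime (hl : remaining G d l = ∅) :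
    IsHPartition G (removalTime G d) l d := by
  refine ⟨fun v => ⟨one_le_removalTime hl v, removalTime_le hl v⟩, fun v => ?_⟩
  have h1 := one_le_removalTime hl v
  have h2 := (succ_lt_removalTime_iff hl (v := v) (i := removalTime G d v - 1) (by omega)).not.1
    (by omega)
  have hsub : {u | G.Adj v u ∧ removalTime G d v ≤ removalTime G d u} ⊆
      {u | G.Adj v u ∧ removalTime G d v - 1 < removalTime G d u} :=
    fun u hu => ⟨hu.1, by have := hu.2; omega⟩
  exact (Set.ncard_le_ncard hsub).trans (not_lt.1 h2)

end

/-! ### The colors at the different levels -/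

section

variable {V : Type u} [Fintype V] (N : Network V) (h : V → ℕ) (d s : ℕ)

/-- The colors `c i v` of the vertices at the levels `i`. -/
structure IsLevelColoring (c : ℕ → V → ℕ) : Prop where
  of_size_le : ∀ i v, Nat.size (N.id v) ≤ i → c i v = N.id v
  of_lt_size : ∀ i v, i < Nat.size (N.id v) → c i v = recolor (2 ^ i) (s + i) d (c (i + 1) v)
    (((N.ports v).filter fun u => h u = h v).map (c (i + 1)))

lemma size_id_le (v : V) : Nat.size (N.id v) ≤ Nat.size (Fintype.card V) :=
  Nat.size_le_size (N.id_le v)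

/-- The color of `v` at level `K - j`. -/
noncomputable def downwardColor (K : ℕ) : ℕ → V → ℕ
  | 0 => N.id
  | j + 1 => fun v => if Nat.size (N.id v) ≤ K - (j + 1) then N.id v else
      recolor (2 ^ (K - (j + 1))) (s + (K - (j + 1))) d (downwardColor K j v)
        (((N.ports v).filter fun u => h u = h v).map (downwardColor K j))

/-- The recursion runs downwards from the bit length of `n`, where all vertices still have their
identity numbers. Here `n` enters only the analysis. -/
lemma exists_isLevelColoring : ∃ c, IsLevelColoring N h d s c := by
  set K := Nat.size (Fintype.card V)
  refine ⟨fun i => downwardColor N h d s K (K - i), fun i v hi => ?_, fun i v hi => ?_⟩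
  · rcases Nat.lt_or_ge i K with hK | hK
    · obtain ⟨j, hj⟩ : ∃ j, K - i = j + 1 := ⟨K - i - 1, by omega⟩
      have hij : K - (j + 1) = i := by omega
      simp only [hj, downwardColor, hij, if_pos hi]
    · simp only [Nat.sub_eq_zero_of_le hK, downwardColor]
  · have hK := hi.trans_le (size_id_le N v)
    obtain ⟨j, hj⟩ : ∃ j, K - i = j + 1 := ⟨K - i - 1, by omega⟩
    have hij : K - (j + 1) = i := by omega
    have hj' : K - (i + 1) = j := by omega
    simp only [hj, hj', downwardColor, hij, if_neg (not_le.2 hi)]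

end

lemma countP_le_add_of_imp {α : Type u} (p q r : α → Bool) (L : List α)
    (himp : ∀ x ∈ L, p x → q x ∨ r x) : L.countP p ≤ L.countP q + L.countP r := by
  induction L with
  | nil => simp
  | cons b L ih =>
    have h1 := ih fun x hx => himp x (by simp [hx])
    have h2 := himp b (by simp)
    simp only [List.countP_cons]
    cases hp : p b <;> cases hq : q b <;> cases hr : r b <;> simp_all <;> omega

namespace IsLevelColoring

variable {V : Type u} [Fintype V] {N : Network V} {h : V → ℕ} {d s : ℕ} {c : ℕ → V → ℕ}

lemma lt_of_size_le (hc : IsLevelColoring N h d s c) {i : ℕ} {v : V}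
    (hi : Nat.size (N.id v) ≤ i) : c i v < 2 ^ i := by
  rw [hc.of_size_le i v hi]
  exact Nat.size_le.1 hi

lemma le_of_lt_size (hc : IsLevelColoring N h d s c) {i : ℕ} {v : V}
    (hi : i < Nat.size (N.id v)) : 2 ^ i ≤ c i v := by
  rw [hc.of_lt_size i v hi]
  exact le_recolor ..

lemma lt_add_sq (hc : IsLevelColoring N h d s c) (i : ℕ) (v : V) :
    c i v < 2 ^ i + (2 ^ (s + i)) ^ 2 := by
  rcases Nat.lt_or_ge i (Nat.size (N.id v)) with hi | hi
  · rw [hc.of_lt_size i v hi]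
    exact recolor_lt ..
  · exact (hc.lt_of_size_le hi).trans_le (Nat.le_add_right _ _)

/-- With `Q = 2^(s+i) ≥ 8`, the bound `2 * 2^i + 4Q²` on the colors at level `i + 1` is at most
`Q³`, the number of available polynomials. -/
lemma succ_lt_cube (hc : IsLevelColoring N h d s c) (hs : 3 ≤ s) (i : ℕ) (v : V) :
    c (i + 1) v < (2 ^ (s + i)) ^ 3 := by
  refine (hc.lt_add_sq (i + 1) v).trans_le ?_
  have h1 : 2 ^ i ≤ 2 ^ (s + i) := Nat.pow_le_pow_right (by norm_num) (by omega)
  have h2 : 2 ^ 3 ≤ 2 ^ (s + i) := Nat.pow_le_pow_right (by norm_num) (by omega)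
  rw [← add_assoc, pow_succ 2 i, pow_succ 2 (s + i)]
  generalize 2 ^ (s + i) = Q at *
  generalize 2 ^ i = q at *
  nlinarith [Nat.mul_le_mul h2 (Nat.le_refl (Q * Q)), Nat.mul_le_mul h2 (Nat.le_refl Q)]

/-- A vertex that has not yet started has its identity number, below `2^i`, as color; recolored
neighbors have colors at least `2^i`, and the others have different identity numbers. -/
lemma countP_eq_zero (hc : IsLevelColoring N h d s c) {i : ℕ} {v : V}
    (hi : Nat.size (N.id v) ≤ i) :
    ((N.ports v).filter fun u => h u = h v).countP (fun u => decide (c i u = c i v)) = 0 := by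
  rw [List.countP_eq_zero]
  intro u hu
  have hadj : N.graph.Adj v u := (N.mem_ports v u).1 (List.mem_of_mem_filter hu)
  simp only [decide_eq_true_eq]
  intro huv
  rcases Nat.lt_or_ge i (Nat.size (N.id u)) with hi' | hi'
  · have h1 := hc.le_of_lt_size hi'
    have h2 := hc.lt_of_size_le hi
    omega
  · rw [hc.of_size_le i v hi, hc.of_size_le i u hi'] at huv
    exact hadj.ne (N.id_injective huv).symm

/-- Equal new colors force equal points and values. So the old colors agreed, or the neighbor is a
conflict at the point chosen by `v`. -/
lemma countP_le_succ_add (hc : IsLevelColoring N h d s c) (hs : 3 ≤ s)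
    (hd : ∀ v, ((N.ports v).filter fun u => h u = h v).length ≤ d) {i : ℕ} {v : V}
    (hi : i < Nat.size (N.id v)) :
    ((N.ports v).filter fun u => h u = h v).countP (fun u => decide (c i u = c i v)) ≤
      ((N.ports v).filter fun u => h u = h v).countP
        (fun u => decide (c (i + 1) u = c (i + 1) v)) + 2 * d / 2 ^ (s + i) := by
  set L := (N.ports v).filter fun u => h u = h v
  have hconf := conflicts_pickPoint_le (s := s + i) (d := d) (c := c (i + 1) v)
    (L := L.map (c (i + 1))) (by omega) (hc.succ_lt_cube hs i v)
    (by simpa using fun u _ => hc.succ_lt_cube hs i u) (by simpa using hd v)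
  refine le_trans ?_ (Nat.add_le_add_left hconf _)
  rw [conflicts, List.countP_map]
  refine countP_le_add_of_imp _ _ _ _ fun u _ huv => ?_
  simp only [decide_eq_true_eq, Function.comp_apply] at huv ⊢
  rcases Nat.lt_or_ge i (Nat.size (N.id u)) with hi' | hi'
  · rw [hc.of_lt_size i v hi, hc.of_lt_size i u hi', recolor_eq_iff] at huv
    obtain ⟨h1, h2⟩ := huv
    rw [h1] at h2
    by_cases hcuv : c (i + 1) u = c (i + 1) v
    · exact Or.inl hcuv
    · exact Or.inr ⟨hcuv, h2⟩
  · have h1 := hc.le_of_lt_size hi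
    have h2 := hc.lt_of_size_le hi'
    omega

/-- At level `i` a vertex has few neighbors of its own color in its `H`-set. -/
lemma countP_le (hc : IsLevelColoring N h d s c) (hs : 3 ≤ s)
    (hd : ∀ v, ((N.ports v).filter fun u => h u = h v).length ≤ d) (i : ℕ) (v : V) :
    ((N.ports v).filter fun u => h u = h v).countP (fun u => decide (c i u = c i v)) ≤
      4 * d / 2 ^ (s + i) := by
  -- Induction on the distance up to the starting level of `v`, where the defect is 0. The bound at
  -- level `i + 1` is `2d/2^(s+i)`, and the step to level `i` adds as much again.
  obtain ⟨j, hj⟩ : ∃ j, Nat.size (N.id v) ≤ i + j := ⟨_, Nat.le_add_left _ _⟩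
  induction j generalizing i with
  | zero => exact (hc.countP_eq_zero hj).trans_le (Nat.zero_le _)
  | succ j ih =>
    rcases Nat.lt_or_ge i (Nat.size (N.id v)) with hi | hi
    · have h1 := ih (i + 1) (by omega)
      have h2 := hc.countP_le_succ_add hs hd hi
      have h3 : 4 * d / 2 ^ (s + (i + 1)) = 2 * d / 2 ^ (s + i) := by
        rw [← add_assoc, pow_succ', show 4 * d = 2 * (2 * d) by ring,
          Nat.mul_div_mul_left _ _ (by norm_num)]
      have h4 : 2 * d / 2 ^ (s + i) + 2 * d / 2 ^ (s + i) ≤ 4 * d / 2 ^ (s + i) := by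
        rw [show 4 * d = 2 * d + 2 * d by ring]
        exact Nat.div_add_div_le_add_div
      omega
    · exact (hc.countP_eq_zero hi).trans_le (Nat.zero_le _)

lemma isDefectiveColoring (hc : IsLevelColoring N h d s c) (hs : 3 ≤ s)
    (hd : ∀ v, ((N.ports v).filter fun u => h u = h v).length ≤ d) (i : ℕ) :
    IsDefectiveColoring (N.graph.induce {v | h v = i}) (4 * d / 2 ^ s) ((2 ^ s) ^ 2)
      (fun v => c 0 v.1) := by
  classical
  refine ⟨fun v => ?_, fun v => ?_⟩
  -- Identity numbers are positive, so every vertex is recolored at level 0 and its color is at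
  -- least `2^0 = 1`.
  · have h0 : 0 < Nat.size (N.id v) := Nat.size_pos.2 (N.one_le_id v)
    have h1 := hc.le_of_lt_size h0
    have h2 := hc.lt_add_sq 0 v
    simp only [pow_zero, add_zero] at h1 h2
    exact ⟨h1, show c 0 v.1 ≤ _ by omega⟩
  · have h1 := hc.countP_le hs hd 0 v.1
    rw [List.countP_filter, add_zero] at h1
    refine le_trans ?_ h1
    rw [← Set.ncard_image_of_injective _ Subtype.val_injective]
    have h2 := ncard_adj_eq_countP N v.1 (fun u => c 0 u = c 0 v ∧ h u = h v)
    simp only [Bool.decide_and] at h2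
    rw [← h2]
    refine Set.ncard_le_ncard ?_
    rintro _ ⟨u, hu, rfl⟩
    exact ⟨hu.1, hu.2, u.2.trans v.2.symm⟩

end IsLevelColoring

/-! ### The orientation determined by an `H`-partition and a coloring -/

section

variable {V : Type u} {G : SimpleGraph V} {h φ : V → ℕ}

lemma orientationOf_isAcyclic : (orientationOf G h φ).IsAcyclic := by
  have key : ∀ v u, Relation.TransGen (orientationOf G h φ).dir v u →
      h v < h u ∨ (h v = h u ∧ φ v < φ u) := by
    intro v u hvu
    induction hvu with
    | single h1 => exact h1.2
    | tail _ h2 ih =>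
      have := h2.2
      omega
  intro v hv
  have := key v v hv
  omega

variable [Fintype V]

lemma orientationOf_outDegree_le {l d : ℕ} (hh : IsHPartition G h l d) :
    (orientationOf G h φ).outDegree ≤ d := by
  refine Finset.sup_le fun v _ => le_trans (Set.ncard_le_ncard ?_) (hh.2 v)
  intro u hu
  exact ⟨hu.1, by have := hu.2; omega⟩

lemma orientationOf_deficit_le {m p : ℕ}
    (hφ : ∀ i, IsDefectiveColoring (G.induce {v | h v = i}) m p (fun v => φ v.1)) :
    (orientationOf G h φ).deficit ≤ m := by
  refine Finset.sup_le fun v _ => le_trans ?_ ((hφ (h v)).2 ⟨v, rfl⟩)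
  rw [← Set.ncard_image_of_injective _ Subtype.val_injective]
  refine Set.ncard_le_ncard ?_
  rintro u ⟨h1, h2, h3⟩
  have h4 : ¬ (h v < h u ∨ (h v = h u ∧ φ v < φ u)) := fun hd => h2 ⟨h1, hd⟩
  have h5 : ¬ (h u < h v ∨ (h u = h v ∧ φ u < φ v)) := fun hd => h3 ⟨h1.symm, hd⟩
  have h6 : h u = h v := by omega
  have h7 : φ u = φ v := by omega
  exact ⟨⟨u, h6⟩, ⟨h1, h7⟩, rfl⟩

/-- The rank `(h - 1) * p + φ` lies between 1 and `l * p` and increases along every arc. -/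
lemma orientationOf_length_le {l p : ℕ} (hh : ∀ v, 1 ≤ h v ∧ h v ≤ l)
    (hφ : ∀ v, 1 ≤ φ v ∧ φ v ≤ p) : (orientationOf G h φ).length ≤ l * p := by
  refine Finset.sup_le fun v _ => csSup_le' ?_
  rintro k ⟨q, -, -, hq⟩
  have key : ∀ i : Fin (k + 1), (i : ℕ) + 1 ≤ (h (q i) - 1) * p + φ (q i) := by
    intro i
    induction i using Fin.induction with
    | zero =>
      have := (hφ (q 0)).1
      simp only [Fin.val_zero]
      omega
    | succ i ih =>
      have h1 := (hq i).2
      have h2 := hφ (q i.castSucc)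
      have h3 := hφ (q i.succ)
      have h4 := hh (q i.castSucc)
      simp only [Fin.val_castSucc, Fin.val_succ] at ih ⊢
      rcases h1 with h1 | ⟨h1, h1'⟩
      · have h5 : (h (q i.castSucc) - 1 + 1) * p ≤ (h (q i.succ) - 1) * p :=
          Nat.mul_le_mul_right _ (by omega)
        rw [add_mul, one_mul] at h5
        omega
      · rw [← h1]
        omega
  have h1 := key (Fin.last k)
  have h2 := hh (q (Fin.last k))
  have h3 := hφ (q (Fin.last k))
  have h4 : (h (q (Fin.last k)) - 1 + 1) * p ≤ l * p := Nat.mul_le_mul_right _ (by omega)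
  rw [add_mul, one_mul] at h4
  simp only [Fin.val_last] at h1
  omega

lemma PartialOrientation.length_eq_zero (σ : PartialOrientation G) (hV : Fintype.card V ≤ 1) :
    σ.length = 0 := by
  refine Nat.le_zero.1 (Finset.sup_le fun v _ => csSup_le' ?_)
  rintro k ⟨q, hq, -, -⟩
  have := Fintype.card_le_of_injective q hq
  simp only [Fintype.card_fin] at this
  simp only [nonpos_iff_eq_zero]
  omega

end

/-! ### Correctness and running time -/

section

/-- The state of `v` after `r` rounds. -/
noncomputable def procState {V : Type u} [Fintype V] (d s : ℕ) (N : Network V) (r : ℕ) (v : V) :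
    ProcState :=
  (procSystem d s).trajectory N r v

variable {V : Type u} [Fintype V] {N : Network V} {d l s : ℕ}

lemma procState_succ (r : ℕ) (v : V) : procState d s N (r + 1) v =
    procStep d s (procState d s N r v) ((N.ports v).map (procState d s N r)) :=
  rfl

/-- The joining rule is the peeling rule seen locally: by induction, the neighbors that have not
joined are the remaining ones. -/
lemma procState_joined_and_clock (hl : remaining N.graph d l = ∅) (r : ℕ) (v : V) :
    ((procState d s N r v).joined ↔ removalTime N.graph d v ≤ r) ∧
      (procState d s N r v).clock = min r (removalTime N.graph d v) := by
  classical
  induction r generalizing v with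
  | zero =>
    have := one_le_removalTime hl v
    exact ⟨⟨False.elim, fun h => by omega⟩, by simp [procState, SyncSystem.trajectory, procSystem]⟩
  | succ r ih =>
    obtain ⟨h1, h2⟩ := ih v
    by_cases hv : removalTime N.graph d v ≤ r
    · have hj := h1.2 hv
      have key : (procState d s N (r + 1) v).joined ∧
          (procState d s N (r + 1) v).clock =
            (procState d s N r v).clock := by
        rw [procState_succ, procStep]
        rw [if_pos hj]
        split_ifs <;> exact ⟨hj, rfl⟩
      exact ⟨iff_of_true key.1 (by omega), by omega⟩
    · have hj := h1.not.2 hv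
      have key : ((procState d s N (r + 1) v).joined ↔
          (((N.ports v).map (procState d s N r)).countP
            fun y => decide (¬ ProcState.joined y)) ≤ d) ∧
          (procState d s N (r + 1) v).clock =
            (procState d s N r v).clock + 1 := by
        rw [procState_succ, procStep]
        rw [if_neg hj]
        exact ⟨Iff.rfl, rfl⟩
      have hcount : (((N.ports v).map (procState d s N r)).countP
            fun y => decide (¬ ProcState.joined y)) =
          {u | N.graph.Adj v u ∧ r < removalTime N.graph d u}.ncard := by
        rw [ncard_adj_eq_countP, List.countP_map]
        refine List.countP_congr fun u _ => ?_
        simp only [Function.comp_apply, decide_eq_true_eq, (ih u).1, not_le]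
      refine ⟨?_, by omega⟩
      rw [key.1, hcount, ← not_lt, ← succ_lt_removalTime_iff hl (by omega), not_lt]

variable {c : ℕ → V → ℕ}

/-- The invariant that removes timing from the analysis: whatever the order of the descents, every
color computed is the one prescribed by the level coloring `c`. -/
lemma procState_col (hl : remaining N.graph d l = ∅)
    (hc : IsLevelColoring N (removalTime N.graph d) d s c) (r : ℕ) (v : V) :
    (procState d s N r v).level ≤ Nat.size (N.id v) ∧
      ∀ i, (procState d s N r v).level ≤ i →
        (procState d s N r v).col i = c i v := by
  classical
  induction r generalizing v with
  | zero => exact ⟨le_rfl, fun i hi => (hc.of_size_le i v hi).symm⟩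
  | succ r ih =>
    obtain ⟨h1, h2⟩ := ih v
    have hclock := fun u => (procState_joined_and_clock (s := s) hl r u).2
    have hjoin := fun u => (procState_joined_and_clock (s := s) hl r u).1
    rw [procState_succ]
    generalize hx : procState d s N r = x at h1 h2 ih hclock hjoin ⊢
    unfold procStep
    split_ifs with hj hm
    · obtain ⟨hm0, hm⟩ := hm
      have hm' : ∀ u ∈ N.ports v, (x u).joined ∧
          ((x u).clock = (x v).clock → (x u).level ≤ (x v).level) :=
        fun u hu => hm _ (List.mem_map_of_mem hu)
      refine ⟨(Nat.sub_le _ _).trans h1, fun i hi => ?_⟩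
      obtain ⟨k, hk⟩ : ∃ k, (x v).level = k + 1 := ⟨(x v).level - 1, by omega⟩
      simp only [hk, Nat.add_sub_cancel] at hi ⊢
      rcases hi.eq_or_lt with rfl | hi
      · rw [Function.update_self, hc.of_lt_size k v (by omega), h2 (k + 1) hk.le]
        congr 1
        rw [List.filter_map, List.map_map]
        have hv := (hjoin v).1 hj
        have hf : (N.ports v).filter ((fun y => decide (ProcState.clock y = (x v).clock)) ∘ x) =
            (N.ports v).filter
              fun u => removalTime N.graph d u = removalTime N.graph d v := by
          refine List.filter_congr fun u hu => ?_
          have hu' := (hjoin u).1 (hm' u hu).1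
          have e1 := hclock u
          have e2 := hclock v
          rw [min_eq_right hu'] at e1
          rw [min_eq_right hv] at e2
          simp only [Function.comp_apply]
          rw [e1, e2]
        rw [hf]
        refine List.map_congr_left fun u hu => ?_
        obtain ⟨hup, hur⟩ := List.mem_filter.1 hu
        rw [← hf] at hu
        have hcl := (List.mem_filter.1 hu).2
        simp only [Function.comp_apply, decide_eq_true_eq] at hcl ⊢
        exact (ih u).2 _ (hk ▸ (hm' u hup).2 hcl)
      · rw [Function.update_of_ne (by omega)]
        exact h2 i (by omega)
    · exact ⟨h1, h2⟩
    · exact ⟨h1, h2⟩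

/-- After `l` rounds all have joined, so a vertex above level 0 is blocked only by a neighbor at a
higher level. A vertex of maximal level is never blocked. -/
lemma procState_level_le (hl : remaining N.graph d l = ∅)
    (hc : IsLevelColoring N (removalTime N.graph d) d s c) (j : ℕ) (v : V) :
    (procState d s N (l + j) v).level ≤ Nat.size (Fintype.card V) - j := by
  classical
  induction j generalizing v with
  | zero => exact (procState_col hl hc l v).1.trans (size_id_le N v)
  | succ j ih =>
    have hjoin : ∀ u, (procState d s N (l + j) u).joined := fun u =>
      (procState_joined_and_clock hl _ u).1.2
        ((removalTime_le hl u).trans (Nat.le_add_right _ _))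
    rw [← add_assoc, procState_succ]
    generalize hx : procState d s N (l + j) = x at ih hjoin ⊢
    have hv := ih v
    unfold procStep
    rw [if_pos (hjoin v)]
    split_ifs with hm
    · simp only
      omega
    · by_cases h0 : (x v).level = 0
      · omega
      · obtain ⟨u, -, hu⟩ : ∃ u ∈ N.ports v, (x v).level < (x u).level := by
          by_contra! hall
          refine hm ⟨h0, fun y hy => ?_⟩
          obtain ⟨u, hu, rfl⟩ := List.mem_map.1 hy
          exact ⟨hjoin u, fun _ => hall u hu⟩
        have := ih u
        omega

/-- When the `H`-partition takes `l` rounds, the procedure halts after `l + O(log n)` rounds. -/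
lemma exists_procSystem_output (hl : remaining N.graph d l = ∅) (hs : 3 ≤ s) :
    ∃ out : V → VertexOutput,
      (procSystem d s).toAlgorithm.ComputesWithin N (l + Nat.size (Fintype.card V) + 1) out ∧
      IsPartialOrientationOutput N out l d (4 * d / 2 ^ s) ((2 ^ s) ^ 2) := by
  obtain ⟨c, hc⟩ := exists_isLevelColoring N (removalTime N.graph d) d s
  set T := l + Nat.size (Fintype.card V)
  have hlev : ∀ v, (procState d s N T v).level = 0 := fun v => by
    have := procState_level_le hl hc (Nat.size (Fintype.card V)) v
    exact Nat.le_zero.1 (this.trans (Nat.sub_self _).le)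
  have hle : ∀ v, removalTime N.graph d v ≤ T := fun v =>
    (removalTime_le hl v).trans (Nat.le_add_right _ _)
  have hjoin : ∀ v, (procState d s N T v).joined := fun v =>
    (procState_joined_and_clock hl T v).1.2 (hle v)
  have hclock : ∀ v, (procState d s N T v).clock = removalTime N.graph d v :=
    fun v => (procState_joined_and_clock hl T v).2.trans (min_eq_right (hle v))
  have hcol : ∀ v, (procState d s N T v).col 0 = c 0 v := fun v =>
    (procState_col hl hc T v).2 0 (hlev v).le
  have hd : ∀ v, ((N.ports v).filter fun u =>
      removalTime N.graph d u = removalTime N.graph d v).length ≤ d := fun v => by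
    rw [← List.countP_eq_length_filter, ← ncard_adj_eq_countP]
    refine le_trans (Set.ncard_le_ncard ?_) ((isHPartition_removalTime hl).2 v)
    exact fun u hu => ⟨hu.1, hu.2.ge⟩
  -- The vertex type of the induced subgraph depends on the index function, so the equalities are
  -- substituted for variables.
  have hdef : ∀ h' φ' : V → ℕ, h' = removalTime N.graph d → φ' = c 0 → ∀ i,
      IsDefectiveColoring (N.graph.induce {v | h' v = i}) (4 * d / 2 ^ s) ((2 ^ s) ^ 2)
        (fun v => φ' v.1) := by
    rintro _ _ rfl rfl i
    exact hc.isDefectiveColoring hs hd i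
  refine ⟨_, (procSystem d s).computesWithin_toAlgorithm N fun v => ⟨hjoin v, hlev v⟩,
    ?_, ?_, ?_⟩
  · change IsHPartition N.graph (fun v => (procState d s N T v).clock) l d
    simp only [hclock]
    exact isHPartition_removalTime hl
  · exact hdef _ _ (funext hclock) (funext hcol)
  · classical
    intro v u huv
    have hu : (N.ports v).idxOf u < (N.ports v).length :=
      List.idxOf_lt_length_of_mem ((N.mem_ports v u).2 huv)
    change ((List.map (procState d s N T) (N.ports v))[(N.ports v).idxOf u]?).elim .unoriented
      (procLabel (procState d s N T v)) = _
    rw [List.getElem?_map, List.getElem?_eq_getElem hu, List.getElem_idxOf]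
    have huv' := huv.symm
    simp only [Option.map_some, Option.elim, procLabel, PartialOrientation.label, orientationOf,
      huv, huv', true_and]
    rfl

end

/-! ### The constants -/

lemma exists_two_pow_between {M : ℕ} (hM : 8 ≤ M) : ∃ s, 3 ≤ s ∧ M ≤ 2 ^ s ∧ 2 ^ s ≤ 2 * M := by
  have h1 : 1 < M := by omega
  refine ⟨Nat.clog 2 M, ?_, Nat.le_pow_clog (by norm_num) M, ?_⟩
  · have h : 2 ^ 3 ≤ 2 ^ Nat.clog 2 M := le_trans (by omega) (Nat.le_pow_clog (by norm_num) M)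
    exact (Nat.pow_le_pow_iff_right (by norm_num)).1 h
  · have h := Nat.pow_pred_clog_lt_self (b := 2) (by norm_num) h1
    have h3 : 0 < Nat.clog 2 M := Nat.clog_pos (by norm_num) h1
    obtain ⟨k, hk⟩ : ∃ k, Nat.clog 2 M = k + 1 := ⟨Nat.clog 2 M - 1, by omega⟩
    rw [hk] at h ⊢
    simp only [Nat.pred_eq_sub_one, Nat.add_sub_cancel] at h
    rw [pow_succ]
    omega

lemma four_mul_floor_div_le {ε : ℝ} (hε : 0 < ε) {a t q : ℕ} (ht : 0 < t)
    (hq : 4 * (2 + ε) * t ≤ q) : 4 * ⌊(2 + ε) * (a : ℝ)⌋₊ / q ≤ a / t := by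
  have ht' : (0 : ℝ) < t := by exact_mod_cast ht
  have hq0 : (0 : ℝ) < q := lt_of_lt_of_le (by positivity) hq
  rw [Nat.le_div_iff_mul_le ht, ← Nat.cast_le (α := ℝ)]
  have h1 : ((4 * ⌊(2 + ε) * (a : ℝ)⌋₊ / q : ℕ) : ℝ) ≤ (4 * ((2 + ε) * a)) / q := by
    refine Nat.cast_div_le.trans ?_
    push_cast
    gcongr
    exact Nat.floor_le (by positivity)
  push_cast at h1 ⊢
  calc _ ≤ (4 * ((2 + ε) * a)) / q * t := by gcongr
    _ = a * (4 * (2 + ε) * t) / q := by ring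
    _ ≤ a * q / q := by gcongr
    _ = a := by field_simp

lemma size_le_two_mul_logb {n : ℕ} (hn : 2 ≤ n) : (Nat.size n : ℝ) ≤ 2 * Real.logb 2 n := by
  obtain ⟨k, hk⟩ : ∃ k, Nat.size n = k + 1 :=
    ⟨Nat.size n - 1, by have := Nat.size_pos.2 (by omega : 0 < n); omega⟩
  have h1 : 2 ^ k ≤ n := Nat.lt_size.1 (by omega)
  have hn2 : (2 : ℝ) ≤ n := by exact_mod_cast hn
  have h2 : (k : ℝ) ≤ Real.logb 2 n := by
    rw [Real.le_logb_iff_rpow_le (by norm_num) (by linarith), Real.rpow_natCast]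
    exact_mod_cast h1
  have h3 : 1 ≤ Real.logb 2 n := by
    rw [Real.le_logb_iff_rpow_le (by norm_num) (by linarith)]
    simpa using hn2
  rw [hk]
  push_cast
  linarith

end DistOrient

theorem mainTheorem5 (ε : ℝ) (hε : 0 < ε) :
    ∃ (C : ℝ) (procedure : ℕ → ℕ → DistOrient.Algorithm DistOrient.VertexOutput),
      0 < C ∧
      ∀ (a t : ℕ), 0 < t →
      ∀ (V : Type u) [Fintype V] (N : DistOrient.Network V),
        DistOrient.arboricity N.graph ≤ a →
        ∃ (T l p : ℕ) (out : V → DistOrient.VertexOutput) (σ : DistOrient.PartialOrientation N.graph),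
          (procedure a t).ComputesWithin N T out ∧
          (2 ≤ Fintype.card V → (T : ℝ) ≤ C * Real.logb 2 (Fintype.card V)) ∧
          DistOrient.IsPartialOrientationOutput N out l ⌊(2 + ε) * (a : ℝ)⌋₊ (a / t) p ∧
          (2 ≤ Fintype.card V → (l : ℝ) ≤ C * Real.logb 2 (Fintype.card V)) ∧
          (p : ℝ) ≤ C * (t : ℝ) ^ 2 ∧
          DistOrient.Announces N out σ ∧
          σ.IsAcyclic ∧
          σ.outDegree ≤ ⌊(2 + ε) * (a : ℝ)⌋₊ ∧
          (σ.length : ℝ) ≤ C * ((t : ℝ) ^ 2 * Real.logb 2 (Fintype.card V)) ∧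
          σ.deficit ≤ a / t := by
  obtain ⟨C₁, hC₁, hlevels⟩ := DistOrient.exists_remaining_eq_empty.{u} hε
  -- `2^s ≥ M * t` gives `4d/2^s ≤ 4(2+ε)a/(4(2+ε)t) = a/t`, and `M ≥ 8` ensures `s ≥ 3`.
  set M : ℕ := ⌈4 * (2 + ε)⌉₊ with hMdef
  have hM : 4 * (2 + ε) ≤ (M : ℝ) := Nat.le_ceil _
  have hM8 : 8 ≤ M := by
    have : (8 : ℝ) ≤ M := by linarith
    exact_mod_cast this
  have hs : ∀ t : ℕ, ∃ s, 0 < t → 3 ≤ s ∧ M * t ≤ 2 ^ s ∧ 2 ^ s ≤ 2 * (M * t) := fun t => by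
    rcases Nat.eq_zero_or_pos t with rfl | ht
    · exact ⟨0, fun h => absurd h (lt_irrefl 0)⟩
    · obtain ⟨s, hs⟩ := DistOrient.exists_two_pow_between (M := M * t) (by nlinarith)
      exact ⟨s, fun _ => hs⟩
  choose s hs using hs
  set C₂ : ℝ := (2 * M) ^ 2
  have hC₂ : 1 ≤ C₂ := by
    have : (8 : ℝ) ≤ M := by exact_mod_cast hM8
    simp only [C₂]
    nlinarith
  -- `C₁` covers the peeling, 2 the bit length of `n`, 1 the last round; `C₂` covers the colors.
  refine ⟨(C₁ + 3) * C₂, fun a t =>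
    (DistOrient.procSystem ⌊(2 + ε) * (a : ℝ)⌋₊ (s t)).toAlgorithm, by positivity,
    fun a t ht V _ N hN => ?_⟩
  obtain ⟨l, hl, hlog⟩ := hlevels V N.graph a hN
  obtain ⟨hs3, hsM, hsM'⟩ := hs t ht
  obtain ⟨out, hout, hspec⟩ := DistOrient.exists_procSystem_output hl hs3
  have hdef : 4 * ⌊(2 + ε) * (a : ℝ)⌋₊ / 2 ^ s t ≤ a / t := by
    refine DistOrient.four_mul_floor_div_le hε ht ?_
    calc 4 * (2 + ε) * (t : ℝ) ≤ M * t := by gcongr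
      _ ≤ ((2 ^ s t : ℕ) : ℝ) := by exact_mod_cast hsM
  have hcol : ∀ i, DistOrient.IsDefectiveColoring (N.graph.induce {v | (out v).hIndex = i})
      (a / t) ((2 ^ s t) ^ 2) (fun v => (out v.1).color) := fun i =>
    ⟨(hspec.coloring i).1, fun v => ((hspec.coloring i).2 v).trans hdef⟩
  have hcolor : ∀ v, 1 ≤ (out v).color ∧ (out v).color ≤ (2 ^ s t) ^ 2 :=
    fun v => (hcol _).1 ⟨v, rfl⟩
  have hp : (((2 ^ s t) ^ 2 : ℕ) : ℝ) ≤ C₂ * (t : ℝ) ^ 2 := by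
    have h : ((2 ^ s t : ℕ) : ℝ) ≤ 2 * (M * t) := by exact_mod_cast hsM'
    calc (((2 ^ s t) ^ 2 : ℕ) : ℝ) = ((2 ^ s t : ℕ) : ℝ) ^ 2 := by push_cast; ring
      _ ≤ (2 * (M * t)) ^ 2 := by gcongr
      _ = C₂ * (t : ℝ) ^ 2 := by simp only [C₂]; ring
  have hlog0 : 0 ≤ Real.logb 2 (Fintype.card V) := by
    rcases Nat.eq_zero_or_pos (Fintype.card V) with h0 | h0
    · simp [h0]
    · exact Real.logb_nonneg (by norm_num) (by exact_mod_cast h0)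
  have hCl : C₁ + 3 ≤ (C₁ + 3) * C₂ := le_mul_of_one_le_right (by positivity) hC₂
  refine ⟨l + Nat.size (Fintype.card V) + 1, l, (2 ^ s t) ^ 2, out, _, hout, fun h2 => ?_,
    ⟨hspec.hPartition, hcol, hspec.orientation⟩, fun h2 => ?_, ?_, hspec.orientation,
    DistOrient.orientationOf_isAcyclic, DistOrient.orientationOf_outDegree_le hspec.hPartition,
    ?_, DistOrient.orientationOf_deficit_le hcol⟩
  · have h3 := DistOrient.size_le_two_mul_logb h2
    have h4 := hlog h2
    have h5 : 1 ≤ Real.logb 2 (Fintype.card V) := by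
      have hn2 : (2 : ℝ) ≤ Fintype.card V := by exact_mod_cast h2
      rw [Real.le_logb_iff_rpow_le (by norm_num) (by linarith)]
      simpa using hn2
    have h6 := mul_le_mul_of_nonneg_right hCl hlog0
    push_cast
    linarith
  · have h6 := mul_le_mul_of_nonneg_right hCl hlog0
    have := hlog h2
    linarith
  · refine hp.trans ?_
    gcongr
    exact le_mul_of_one_le_left (by positivity) (by linarith)
  -- For `n ≤ 1` the logarithm gives no room, but the injective paths then have no edges.
  · rcases Nat.lt_or_ge (Fintype.card V) 2 with h1 | h2
    · rw [DistOrient.PartialOrientation.length_eq_zero _ (by omega)]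
      push_cast
      positivity
    · have h3 := DistOrient.orientationOf_length_le (G := N.graph) hspec.hPartition.1 hcolor
      calc _ ≤ ((l * (2 ^ s t) ^ 2 : ℕ) : ℝ) := by exact_mod_cast h3
        _ = (l : ℝ) * (((2 ^ s t) ^ 2 : ℕ) : ℝ) := by push_cast; ring
        _ ≤ ((C₁ + 3) * Real.logb 2 (Fintype.card V)) * (C₂ * (t : ℝ) ^ 2) := by
          gcongr
          have := hlog h2
          linarith
        _ = _ := by ring
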